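/- **Theorem (Stability of En-BlendedBDF).** Let $d\in\{2,3\}$ and let $\Omega\subset\mathbb R^d$ be open and bounded. Let $\|\cdot\|$ and $(\cdot,\cdot)$ be the norm and inner product of $L^2(\Omega)$ (for scalars, vectors and, with the Frobenius norm, tensors), $X=H_0^1(\Omega)^d$ the closure of $C_c^\infty(\Omega)^d$ in the $H^1$ norm, $Q=L^2_0(\Omega)$ the space of $L^2$ functions of mean zero, and, for $u,v,w\in X$ and $f\in X'$ (with $(f,v)$ the duality pairing, equal to the $L^2$ inner product if $f\in L^2(\Omega)^d$), $$b^*(u,v,w)=\tfrac12(u\cdot\nabla v,w)-\tfrac12(u\cdot\nabla w,v),\qquad \|f\|_{-1}=\sup_{0\ne v\in X}\frac{(f,v)}{\|\nabla v\|}.$$ For every $C_{\rm inv}>0$ there is a constant $C>0$, depending only on $d$, $\Omega$ and $C_{\rm inv}$, with the following property. Let $h>0$, and let $X_h\subset X$, $Q_h\subset Q$ be finite-dimensional subspaces (for instance conforming finite element spaces on a mesh of maximal element diameter $h$) such that the inverse inequality $h\|\nabla v_h\|\le C_{\rm inv}\|v_h\|$ holds for all $v_h\in X_h$. Let $\nu>0$,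 $\Delta t>0$, let $J\ge 1$ and $N_T$ be integers, and let $f_j^{n}\in X'$ for $1\le j\le J$ and $n\le N_T$. Let $u_{j,h}^n\in X_h$ $(0\le n\le N_T)$ and $p_{j,h}^{n}\in Q_h$ $(3\le n\le N_T)$, $j=1,\dots,J$, be such that for all $j$ and all $2\le n\le N_T-1$ $$\Big(\frac{10u_{j,h}^{n+1}-15u_{j,h}^{n}+6u_{j,h}^{n-1}-u_{j,h}^{n-2}}{6\Delta t},v_h\Big)+b^*\big(\langle u_h\rangle^n,u_{j,h}^{n+1},v_h\big)+b^*\big(u_{j,h}'^{\,n},3u_{j,h}^n-3u_{j,h}^{n-1}+u_{j,h}^{n-2},v_h\big)$$ $$-(p_{j,h}^{n+1},\nabla\cdot v_h)+\nu(\nabla u_{j,h}^{n+1},\nabla v_h)=(f_j^{n+1},v_h)\quad\forall v_h\in X_h,\qquad (\nabla\cdot u_{j,h}^{n+1},q_h)=0\quad\forall q_h\in Q_h,$$ where $$\langle u_h\rangle^n=\frac1J\sum_{j=1}^J\big(3u_{j,h}^n-3u_{j,h}^{n-1}+u_{j,h}^{n-2}\big),\qquad u_{j,h}'^{\,n}=3u_{j,h}^n-3u_{j,h}^{n-1}+u_{j,h}^{n-2}-\langle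 u_h\rangle^n .$$ Suppose that $$C\,\frac{\Delta t}{\nu h}\,\|\nabla u_{j,h}'^{\,n}\|^2\le 1\qquad\text{for } j=1,\dots,J,\ 2\le n\le N_T-1 .$$ Then for every $j$ and every integer $N$ with $2<N\le N_T$ $$\tfrac1{12}\|u_{j,h}^N\|^2+\tfrac1{12}\|3u_{j,h}^N-u_{j,h}^{N-1}\|^2+\tfrac1{12}\|3u_{j,h}^N-3u_{j,h}^{N-1}+u_{j,h}^{N-2}\|^2$$ $$+\tfrac1{24}\sum_{n=2}^{N-1}\|u_{j,h}^{n+1}-3u_{j,h}^n+3u_{j,h}^{n-1}-u_{j,h}^{n-2}\|^2+\tfrac{\Delta t}{4}\sum_{n=2}^{N-1}\nu\|\nabla u_{j,h}^{n+1}\|^2$$ $$\le\sum_{n=2}^{N-1}\frac{\Delta t}{\nu}\|f_j^{n+1}\|_{-1}^2+\tfrac1{12}\|u_{j,h}^2\|^2+\tfrac1{12}\|3u_{j,h}^2-u_{j,h}^1\|^2+\tfrac1{12}\|3u_{j,h}^2-3u_{j,h}^1+u_{j,h}^0\|^2 .$$ -/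

import Mathlib

open MeasureTheory
open scoped ContDiff

noncomputable section

namespace EnBlended

/-- Points of `ℝ^d`, and vector values, with the Euclidean norm. -/
abbrev Vec (d : ℕ) := EuclideanSpace ℝ (Fin d)

/-- `d × d` tensors with the Frobenius norm; the entry `(i, k)` of a velocity gradient is
`∂ₖ vᵢ`. -/
abbrev Tens (d : ℕ) := EuclideanSpace ℝ (Fin d × Fin d)

/-- `L²(Ω; F)`, with its usual norm and inner product. -/
abbrev L2 {d : ℕ} (Ω : Set (Vec d)) (F : Type*) [NormedAddCommGroup F] :=
  Lp F 2 (volume.restrict Ω)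

/-- The classical gradient of a vector field, as a tensor. -/
def jacobian {d : ℕ} (φ : Vec d → Vec d) (x : Vec d) : Tens d :=
  WithLp.toLp 2 fun ik => fderiv ℝ φ x (EuclideanSpace.single ik.2 1) ik.1

/-- The pairs `(φ, ∇φ)` in `L²(Ω)^d × L²(Ω)^{d×d}` for `φ ∈ C_c^∞(Ω)^d`. -/
def testPairs {d : ℕ} (Ω : Set (Vec d)) : Submodule ℝ (L2 Ω (Vec d) × L2 Ω (Tens d)) where
  carrier := {P | ∃ φ : Vec d → Vec d, ContDiff ℝ ∞ φ ∧ HasCompactSupport φ ∧ tsupport φ ⊆ Ω ∧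
    P.1 =ᵐ[volume.restrict Ω] φ ∧ P.2 =ᵐ[volume.restrict Ω] jacobian φ}
  zero_mem' := by
    refine ⟨0, contDiff_const, HasCompactSupport.zero, by simp [tsupport],
      Lp.coeFn_zero _ _ _, ?_⟩
    filter_upwards [Lp.coeFn_zero (Tens d) 2 (volume.restrict Ω)] with x hx
    rw [Prod.snd_zero, hx]
    ext ik
    simp [jacobian]
  add_mem' := by
    rintro P P' ⟨φ, h1, h2, h3, h4, h5⟩ ⟨ψ, k1, k2, k3, k4, k5⟩
    refine ⟨φ + ψ, h1.add k1, h2.add k2,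
      (tsupport_add φ ψ).trans (Set.union_subset h3 k3), ?_, ?_⟩
    · exact (Lp.coeFn_add _ _).trans (h4.add k4)
    · refine (Lp.coeFn_add _ _).trans ((h5.add k5).trans (Filter.Eventually.of_forall ?_))
      intro x
      ext ik
      have a := (h1.differentiable (by simp)) x
      have b := (k1.differentiable (by simp)) x
      simp [jacobian, fderiv_add a b]
  smul_mem' := by
    rintro c P ⟨φ, h1, h2, h3, h4, h5⟩
    refine ⟨c • φ, contDiff_const.smul h1, h2.smul_left (f := fun _ => c),
      (tsupport_smul_subset_right (fun _ => c) φ).trans h3, ?_, ?_⟩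
    · exact (Lp.coeFn_smul _ _).trans (h4.const_smul c)
    · refine (Lp.coeFn_smul _ _).trans
        ((h5.const_smul c).trans (Filter.Eventually.of_forall ?_))
      intro x
      ext ik
      have a := (h1.differentiable (by simp)) x
      simp [jacobian, fderiv_const_smul a]

/-- The velocity space `X = H¹₀(Ω)^d`: the closure of `C_c^∞(Ω)^d` in the `H¹` norm. An element
is stored as the pair `(v, ∇v)` of an `L²` field and its weak gradient. -/
def H10 {d : ℕ} (Ω : Set (Vec d)) : Submodule ℝ (L2 Ω (Vec d) × L2 Ω (Tens d)) :=
  (testPairs Ω).topologicalClosure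

/-- The `L²` field underlying an element of `X`. -/
def vel {d : ℕ} {Ω : Set (Vec d)} (v : H10 Ω) : L2 Ω (Vec d) := v.1.1

/-- The gradient `∇v ∈ L²(Ω)^{d×d}`. -/
def grad {d : ℕ} {Ω : Set (Vec d)} (v : H10 Ω) : L2 Ω (Tens d) := v.1.2

theorem pairing_continuous {d : ℕ} {ι : Type} [Fintype ι] (Ω : Set (Vec d)) (i : ι)
    {g : Vec d → ℝ} (hg : MemLp g 2 (volume.restrict Ω)) :
    Continuous fun P : L2 Ω (EuclideanSpace ℝ ι) => ∫ x in Ω, P x i * g x := by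
  have h : (fun P : L2 Ω (EuclideanSpace ℝ ι) => ∫ x in Ω, P x i * g x) =
      fun P => inner ℝ (hg.toLp g)
        ((EuclideanSpace.proj i : EuclideanSpace ℝ ι →L[ℝ] ℝ).compLp P) := by
    funext P
    rw [L2.inner_def]
    refine integral_congr_ae ?_
    filter_upwards [hg.coeFn_toLp,
      (EuclideanSpace.proj i : EuclideanSpace ℝ ι →L[ℝ] ℝ).coeFn_compLp P] with x h1 h2
    rw [h1, h2]
    simp
  rw [h]
  exact continuous_const.inner
    ((EuclideanSpace.proj i : EuclideanSpace ℝ ι →L[ℝ] ℝ).compLpL 2 (volume.restrict Ω)).continuous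

/-- The second component of an element of `X` is the weak gradient of the first. -/
theorem weak_grad {d : ℕ} {Ω : Set (Vec d)} (v : H10 Ω) {ψ : Vec d → ℝ} (hψ : ContDiff ℝ ∞ ψ)
    (hc : HasCompactSupport ψ) (i k : Fin d) :
    ∫ x in Ω, vel v x i * fderiv ℝ ψ x (EuclideanSpace.single k 1) =
      -∫ x in Ω, grad v x (i, k) * ψ x := by
  have hd : Continuous fun x => fderiv ℝ ψ x (EuclideanSpace.single k 1) :=
    (hψ.continuous_fderiv (by simp)).clm_apply continuous_const
  have hdc : HasCompactSupport fun x => fderiv ℝ ψ x (EuclideanSpace.single k 1) :=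
    hc.fderiv_apply (𝕜 := ℝ) _
  have m1 : MemLp ψ 2 (volume.restrict Ω) := (hψ.continuous.memLp_of_hasCompactSupport hc)
  have m2 : MemLp (fun x => fderiv ℝ ψ x (EuclideanSpace.single k 1)) 2 (volume.restrict Ω) :=
    hd.memLp_of_hasCompactSupport hdc
  have c1 := (pairing_continuous Ω i m2).comp
    (continuous_fst : Continuous (Prod.fst : L2 Ω (Vec d) × L2 Ω (Tens d) → _))
  have c2 := ((pairing_continuous Ω (i, k) m1).comp
    (continuous_snd : Continuous (Prod.snd : L2 Ω (Vec d) × L2 Ω (Tens d) → _))).neg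
  have hv : v.1 ∈ closure (testPairs Ω : Set (L2 Ω (Vec d) × L2 Ω (Tens d))) := v.2
  refine closure_minimal ?_ (isClosed_eq c1 c2) hv
  rintro P ⟨φ, h1, h2, h3, h4, h5⟩
  have e1 : ∫ x in Ω, P.1 x i * fderiv ℝ ψ x (EuclideanSpace.single k 1) =
      ∫ x, φ x i * fderiv ℝ ψ x (EuclideanSpace.single k 1) := by
    rw [integral_congr_ae (g := fun x => φ x i * fderiv ℝ ψ x (EuclideanSpace.single k 1))
      (by filter_upwards [h4] with x hx; rw [hx])]
    refine setIntegral_eq_integral_of_forall_compl_eq_zero fun x hx => ?_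
    rw [image_eq_zero_of_notMem_tsupport (fun h => hx (h3 h))]; simp
  have e2 : ∫ x in Ω, P.2 x (i, k) * ψ x =
      ∫ x, fderiv ℝ φ x (EuclideanSpace.single k 1) i * ψ x := by
    rw [integral_congr_ae (g := fun x => fderiv ℝ φ x (EuclideanSpace.single k 1) i * ψ x)
      (by filter_upwards [h5] with x hx; rw [hx]; rfl)]
    refine setIntegral_eq_integral_of_forall_compl_eq_zero fun x hx => ?_
    rw [fderiv_of_notMem_tsupport (𝕜 := ℝ) (fun h => hx (h3 h))]; simp
  show (∫ x in Ω, P.1 x i * fderiv ℝ ψ x (EuclideanSpace.single k 1)) =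
    -∫ x in Ω, P.2 x (i, k) * ψ x
  rw [e1, e2]
  have hφi : ContDiff ℝ ∞ fun x => φ x i :=
    (EuclideanSpace.proj i : Vec d →L[ℝ] ℝ).contDiff.comp h1
  have hf : ∀ x, fderiv ℝ (fun x => φ x i) x (EuclideanSpace.single k 1) =
      fderiv ℝ φ x (EuclideanSpace.single k 1) i := by
    intro x
    have := ((EuclideanSpace.proj i : Vec d →L[ℝ] ℝ).hasFDerivAt.comp x
      (h1.differentiable (by simp) x).hasFDerivAt).fderiv
    have e : (fun x => φ x i) = (EuclideanSpace.proj i : Vec d →L[ℝ] ℝ) ∘ φ := rfl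
    rw [e, this]; rfl
  simp_rw [← hf]
  have hfc : Continuous fun x => fderiv ℝ (fun x => φ x i) x (EuclideanSpace.single k 1) :=
    (hφi.continuous_fderiv (by simp)).clm_apply continuous_const
  refine integral_mul_fderiv_eq_neg_fderiv_mul_of_integrable ?_ ?_ ?_
    (fun x _ => hφi.differentiable (by simp) x) (fun x _ => hψ.differentiable (by simp) x)
  · exact (hfc.mul hψ.continuous).integrable_of_hasCompactSupport hc.mul_left
  · exact (hφi.continuous.mul hd).integrable_of_hasCompactSupport hdc.mul_left
  · exact (hφi.continuous.mul hψ.continuous).integrable_of_hasCompactSupport hc.mul_left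

/-- The divergence `∇·v ∈ L²(Ω)`, the trace of `∇v`. -/
def div {d : ℕ} {Ω : Set (Vec d)} (v : H10 Ω) : L2 Ω ℝ :=
  (∑ i : Fin d, (EuclideanSpace.proj (i, i) : Tens d →L[ℝ] ℝ)).compLp (grad v)

/-- The pressure space `Q = L²₀(Ω)` of square integrable functions of zero mean. -/
def L20 {d : ℕ} (Ω : Set (Vec d)) : Set (L2 Ω ℝ) := {q | ∫ x in Ω, q x = 0}

/-- `(u·∇v, w) = ∫_Ω ∑ᵢ ∑ₖ uₖ (∂ₖ vᵢ) wᵢ`. -/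
def convect {d : ℕ} {Ω : Set (Vec d)} (u v w : H10 Ω) : ℝ :=
  ∫ x in Ω, ∑ i, ∑ k, vel u x k * grad v x (i, k) * vel w x i

/-- The skew-symmetric trilinear form `b*(u, v, w)`. -/
def bStar {d : ℕ} {Ω : Set (Vec d)} (u v w : H10 Ω) : ℝ :=
  1 / 2 * convect u v w - 1 / 2 * convect u w v

/-- The dual norm `‖f‖₋₁ = sup_{0 ≠ v ∈ X} (f, v) / ‖∇v‖`. -/
def negNorm {d : ℕ} {Ω : Set (Vec d)} (f : H10 Ω →L[ℝ] ℝ) : ℝ :=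
  ⨆ v : {v : H10 Ω // v ≠ 0}, f v.1 / ‖grad v.1‖

/-- The extrapolation `3wⁿ - 3wⁿ⁻¹ + wⁿ⁻²` (used for `n ≥ 2` only). -/
def extrap {d : ℕ} {Ω : Set (Vec d)} (w : ℕ → H10 Ω) (n : ℕ) : H10 Ω :=
  (3 : ℝ) • w n - (3 : ℝ) • w (n - 1) + w (n - 2)

/-- The ensemble mean `⟨u⟩ⁿ`. -/
def mean {d J : ℕ} {Ω : Set (Vec d)} (u : Fin J → ℕ → H10 Ω) (n : ℕ) : H10 Ω :=
  (1 / (J : ℝ)) • ∑ j, extrap (u j) n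

/-- The fluctuation `u'ⱼⁿ`. -/
def fluct {d J : ℕ} {Ω : Set (Vec d)} (u : Fin J → ℕ → H10 Ω) (j : Fin J) (n : ℕ) : H10 Ω :=
  extrap (u j) n - mean u n

/-- The blended difference quotient `(10wⁿ⁺¹ - 15wⁿ + 6wⁿ⁻¹ - wⁿ⁻²) / (6Δt)` (for `n ≥ 2`). -/
def blendedBDF {d : ℕ} {Ω : Set (Vec d)} (Δt : ℝ) (w : ℕ → H10 Ω) (n : ℕ) : H10 Ω :=
  (1 / (6 * Δt)) •
    ((10 : ℝ) • w (n + 1) - (15 : ℝ) • w n + (6 : ℝ) • w (n - 1) - w (n - 2))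

/-- `u j n`, `p j n` are velocities and pressures produced by the fully discrete ensemble scheme
up to time level `NT`; the starting velocities `u j 0`, `u j 1`, `u j 2` are arbitrary in `Xh`. -/
structure IsSchemeSolution {d J : ℕ} {Ω : Set (Vec d)} (Xh : Submodule ℝ (H10 Ω))
    (Qh : Submodule ℝ (L2 Ω ℝ)) (ν Δt : ℝ) (f : Fin J → ℕ → (H10 Ω →L[ℝ] ℝ)) (NT : ℕ)
    (u : Fin J → ℕ → H10 Ω) (p : Fin J → ℕ → L2 Ω ℝ) : Prop where
  vel_mem : ∀ j n, n ≤ NT → u j n ∈ Xh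
  pres_mem : ∀ j n, 2 ≤ n → n < NT → p j (n + 1) ∈ Qh
  momentum : ∀ j n, 2 ≤ n → n < NT → ∀ v ∈ Xh,
    inner ℝ (vel (blendedBDF Δt (u j) n)) (vel v)
      + bStar (mean u n) (u j (n + 1)) v
      + bStar (fluct u j n) (extrap (u j) n) v
      - inner ℝ (p j (n + 1)) (div v)
      + ν * inner ℝ (grad (u j (n + 1))) (grad v)
    = f j (n + 1) v
  mass : ∀ j n, 2 ≤ n → n < NT → ∀ q ∈ Qh, inner ℝ (div (u j (n + 1))) q = 0

end EnBlended

end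

/-! Testing the momentum equation with `v_h = uⱼⁿ⁺¹` turns the blended difference quotient into the
increment of a quadratic energy plus `‖δ‖² / 12`, where `δ` is the third difference of `uⱼ`. Since
the extrapolated velocity is `uⱼⁿ⁺¹ - δ`, skew symmetry leaves `b*(u', δ, uⱼⁿ⁺¹)` as the only
convective contribution. Integrating by parts, so that no derivative falls on `δ`, and applying
Hölder's inequality with exponents `6, 2, 3`, the interpolation `‖δ‖_{L³}² ≤ ‖δ‖_{L⁶} ‖δ‖` and
Sobolev's inequality, one finds
`|b*(u', δ, uⱼⁿ⁺¹)| ≤ M ‖∇u'‖ ‖∇uⱼⁿ⁺¹‖ ‖∇δ‖^{1/2} ‖δ‖^{1/2}`. The inverse inequality and the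
time-step condition absorb this bound into the numerical and the viscous dissipation. -/

noncomputable section

namespace EnBlended

open Filter Topology

open scoped ENNReal NNReal

theorem eLpNorm'_le_rpow_mul_rpow {α E : Type*} [MeasurableSpace α] {μ : Measure α}
    [NormedAddCommGroup E] {f : α → E} (hf : AEStronglyMeasurable f μ) {p q r a b : ℝ}
    (hp : 0 < p) (hq : 0 < q) (hr : 0 < r) (ha : 0 ≤ a) (hb : 0 ≤ b) (hab : a + b = 1)
    (hpqr : a / q + b / r = 1 / p) :
    eLpNorm' f p μ ≤ eLpNorm' f q μ ^ a * eLpNorm' f r μ ^ b := by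
  have weights_add : a * p / q + b * p / r = 1 := by
    field_simp at hpqr ⊢
    linarith
  have integrand_eq (x : α) :
      ‖f x‖ₑ ^ p = (‖f x‖ₑ ^ q) ^ (a * p / q) * (‖f x‖ₑ ^ r) ^ (b * p / r) := by
    rw [← ENNReal.rpow_mul, ← ENNReal.rpow_mul, mul_div_cancel₀ _ hq.ne',
      mul_div_cancel₀ _ hr.ne', ← ENNReal.rpow_add_of_nonneg _ _ (by positivity) (by positivity),
      ← add_mul, hab, one_mul]
  have holder := ENNReal.lintegral_mul_norm_pow_le (hf.enorm.pow_const q) (hf.enorm.pow_const r)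
    (show 0 ≤ a * p / q by positivity) (show 0 ≤ b * p / r by positivity) weights_add
  simp only [← integrand_eq] at holder
  refine (ENNReal.rpow_le_rpow holder (by positivity : 0 ≤ 1 / p)).trans_eq ?_
  rw [ENNReal.mul_rpow_of_nonneg _ _ (by positivity)]
  simp only [eLpNorm'_eq_lintegral_enorm, ← ENNReal.rpow_mul]
  congr 2 <;> field_simp

theorem eLpNorm_three_le {α E : Type*} [MeasurableSpace α] {μ : Measure α}
    [NormedAddCommGroup E] {f : α → E} (hf : AEStronglyMeasurable f μ) :
    eLpNorm f 3 μ ≤ eLpNorm f 6 μ ^ (1 / 2 : ℝ) * eLpNorm f 2 μ ^ (1 / 2 : ℝ) := by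
  simp only [eLpNorm_eq_eLpNorm' (OfNat.ofNat_ne_zero _) (ENNReal.ofNat_ne_top),
    ENNReal.toReal_ofNat]
  exact eLpNorm'_le_rpow_mul_rpow hf (by norm_num) (by norm_num) (by norm_num) (by norm_num)
    (by norm_num) (by norm_num) (by norm_num)

theorem integral_fderiv_apply_eq_zero {E : Type*} [NormedAddCommGroup E] [NormedSpace ℝ E]
    [FiniteDimensional ℝ E] [MeasurableSpace E] [BorelSpace E] (μ : Measure E)
    [μ.IsAddHaarMeasure] {g : E → ℝ} (hg : ContDiff ℝ 1 g) (hc : HasCompactSupport g) (v : E) :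
    ∫ x, fderiv ℝ g x v ∂μ = 0 := by
  have hint : Integrable (fun x => fderiv ℝ g x v) μ :=
    ((hg.continuous_fderiv one_ne_zero).clm_apply continuous_const).integrable_of_hasCompactSupport
      (hc.fderiv_apply ℝ v)
  have hparts := integral_mul_fderiv_eq_neg_fderiv_mul_of_integrable (μ := μ) (f := g)
    (g := fun _ => (1 : ℝ)) (v := v) (by simpa using hint) (by simp)
    (by simpa using hg.continuous.integrable_of_hasCompactSupport hc)
    (fun x _ => hg.differentiable one_ne_zero x) (fun x _ => differentiableAt_const _)
  simpa using hparts.symm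

theorem integral_fderiv_apply_add_mul_div_eq_zero {d : ℕ} {g : Vec d → ℝ} {φ : Vec d → Vec d}
    (hg : ContDiff ℝ 1 g) (hφ : ContDiff ℝ 1 φ) (hc : HasCompactSupport φ) :
    ∫ x, (fderiv ℝ g x (φ x) + g x * ∑ i, jacobian φ x (i, i)) = 0 := by
  have comp_contDiff (i : Fin d) : ContDiff ℝ 1 fun x => φ x i := by fun_prop
  have comp_supp (i : Fin d) : HasCompactSupport fun x => g x * φ x i :=
    (hc.comp_left (g := fun y : Vec d => y i) rfl).mul_left
  have fderiv_comp (i : Fin d) (x v : Vec d) :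
      fderiv ℝ (fun x => φ x i) x v = fderiv ℝ φ x v i := by
    have := ((EuclideanSpace.proj i : Vec d →L[ℝ] ℝ).hasFDerivAt.comp x
      (hφ.differentiable one_ne_zero x).hasFDerivAt).fderiv
    exact DFunLike.congr_fun this v
  have integrand_eq (x : Vec d) : fderiv ℝ g x (φ x) + g x * ∑ i, jacobian φ x (i, i) =
      ∑ i, fderiv ℝ (fun x => g x * φ x i) x (EuclideanSpace.single i 1) := by
    have expand : φ x = ∑ i, φ x i • EuclideanSpace.single i (1 : ℝ) := by
      ext l; simp [Pi.single_apply]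
    conv_lhs => rw [expand]
    simp only [map_sum, map_smul, Finset.mul_sum, ← Finset.sum_add_distrib]
    refine Finset.sum_congr rfl fun i _ => ?_
    rw [fderiv_fun_mul (hg.differentiable one_ne_zero x)
      ((comp_contDiff i).differentiable one_ne_zero x)]
    simp [jacobian, fderiv_comp, add_comm]
  simp only [integrand_eq]
  rw [integral_finsetSum _ fun i _ => ?_]
  · exact Finset.sum_eq_zero fun i _ =>
      integral_fderiv_apply_eq_zero volume (hg.mul (comp_contDiff i)) (comp_supp i) _
  · exact (((hg.mul (comp_contDiff i)).continuous_fderiv one_ne_zero).clm_apply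
      continuous_const).integrable_of_hasCompactSupport ((comp_supp i).fderiv_apply ℝ _)

theorem fderiv_apply_eq_sum_jacobian {d : ℕ} (φ : Vec d → Vec d) (x y : Vec d) (i : Fin d) :
    fderiv ℝ φ x y i = ∑ k, jacobian φ x (i, k) * y k := by
  have expand : y = ∑ k, y k • EuclideanSpace.single k (1 : ℝ) := by
    ext l
    simp [Pi.single_apply]
  conv_lhs => rw [expand]
  simp [jacobian, mul_comm]

theorem norm_fderiv_le_norm_jacobian {d : ℕ} (φ : Vec d → Vec d) (x : Vec d) :
    ‖fderiv ℝ φ x‖ ≤ ‖jacobian φ x‖ := by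
  refine ContinuousLinearMap.opNorm_le_bound _ (norm_nonneg _) fun y => ?_
  rw [← sq_le_sq₀ (norm_nonneg _) (by positivity), mul_pow]
  simp only [EuclideanSpace.real_norm_sq_eq, fderiv_apply_eq_sum_jacobian]
  rw [Fintype.sum_prod_type, Finset.sum_mul]
  exact Finset.sum_le_sum fun i _ => Finset.sum_mul_sq_le_sq_mul_sq _ _ _

theorem add_sum_le_sum_add_of_step {α : Type*} [AddCommGroup α] [PartialOrder α]
    [IsOrderedAddMonoid α] {E D R : ℕ → α} {m N : ℕ} (hmN : m ≤ N)
    (h : ∀ n ∈ Finset.Ico m N, E (n + 1) + D n ≤ R n + E n) :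
    E N + ∑ n ∈ Finset.Ico m N, D n ≤ ∑ n ∈ Finset.Ico m N, R n + E m := by
  rw [← sub_le_sub_iff, ← Finset.sum_Ico_sub E hmN, ← Finset.sum_sub_distrib]
  exact Finset.sum_le_sum fun n hn => sub_le_sub_iff.2 (h n hn)

theorem mul_abs_le_of_abs_le_mul_sqrt {b M a g r s h c ν τ : ℝ} (hh : 0 < h) (hν : 0 < ν)
    (hτ : 0 < τ) (hr : 0 ≤ r) (hs : 0 ≤ s) (hb : |b| ≤ M * (a * g * √(r * s)))
    (hrs : h * r ≤ c * s) (ha : 24 * M ^ 2 * c * (τ / (ν * h)) * a ^ 2 ≤ 1) :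
    τ * |b| ≤ 1 / 24 * s ^ 2 + τ / 4 * (ν * g ^ 2) := by
  have mul_le : r * s ≤ c / h * s ^ 2 := by
    rw [div_mul_eq_mul_div, le_div_iff₀ hh]
    nlinarith
  have sq_le : (τ * |b|) ^ 2 ≤ 4 * (1 / 24 * s ^ 2) * (τ / 4 * (ν * g ^ 2)) :=
    calc (τ * |b|) ^ 2 ≤ (τ * (M * (a * g * √(r * s)))) ^ 2 := by gcongr
      _ = τ ^ 2 * M ^ 2 * a ^ 2 * g ^ 2 * (r * s) := by
          simp only [mul_pow, Real.sq_sqrt (mul_nonneg hr hs)]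
          ring
      _ ≤ τ ^ 2 * M ^ 2 * a ^ 2 * g ^ 2 * (c / h * s ^ 2) := by gcongr
      _ = 1 / 24 * τ * ν * g ^ 2 * s ^ 2 * (24 * M ^ 2 * c * (τ / (ν * h)) * a ^ 2) := by
          field_simp
      _ ≤ 1 / 24 * τ * ν * g ^ 2 * s ^ 2 * 1 := by gcongr
      _ = 4 * (1 / 24 * s ^ 2) * (τ / 4 * (ν * g ^ 2)) := by ring
  have amgm := four_mul_le_sq_add (1 / 24 * s ^ 2) (τ / 4 * (ν * g ^ 2))
  exact le_of_sq_le_sq (by linarith) (by positivity)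

theorem continuous_jacobian {d : ℕ} {φ : Vec d → Vec d} (hφ : ContDiff ℝ 1 φ) :
    Continuous (jacobian φ) := by
  have := hφ.continuous_fderiv one_ne_zero
  unfold jacobian
  fun_prop

theorem support_jacobian_subset {d : ℕ} (φ : Vec d → Vec d) :
    Function.support (jacobian φ) ⊆ tsupport φ := by
  refine Function.support_subset_iff'.2 fun x hx => ?_
  ext ik
  simp [jacobian, fderiv_of_notMem_tsupport (𝕜 := ℝ) hx]

theorem exists_eLpNorm_le_eLpNorm_jacobian {d : ℕ} {Ω : Set (Vec d)}
    (hΩb : Bornology.IsBounded Ω) {p q r : ℝ≥0} (hp : 1 ≤ p) (hpd : p < d)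
    (hpq : (p : ℝ)⁻¹ - (d : ℝ)⁻¹ ≤ (q : ℝ)⁻¹) (hpr : p ≤ r) :
    ∃ K : ℝ≥0, ∀ φ : Vec d → Vec d, ContDiff ℝ 1 φ → tsupport φ ⊆ Ω →
      eLpNorm φ q (volume.restrict Ω) ≤ K * eLpNorm (jacobian φ) r (volume.restrict Ω) := by
  have : IsFiniteMeasure (volume.restrict Ω) := ⟨by simpa using hΩb.measure_lt_top⟩
  let S : ℝ≥0 := eLpNormLESNormFDerivOfLeConst (Vec d) volume Ω p q
  let m : ℝ≥0∞ := volume.restrict Ω Set.univ ^ (1 / (p : ℝ) - 1 / (r : ℝ))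
  have hm_ne_top : m ≠ ⊤ := by
    refine ENNReal.rpow_ne_top_of_nonneg (sub_nonneg.2 ?_) (measure_ne_top _ _)
    gcongr
  refine ⟨S * m.toNNReal, fun φ hφ hs => ?_⟩
  have hsupp : φ.support ⊆ Ω := (subset_tsupport φ).trans hs
  have hsupp' : (jacobian φ).support ⊆ Ω := (support_jacobian_subset φ).trans hs
  calc eLpNorm φ q (volume.restrict Ω)
      = eLpNorm φ q volume := eLpNorm_restrict_eq_of_support_subset hsupp
    _ ≤ S * eLpNorm (fderiv ℝ φ) p volume :=
        eLpNorm_le_eLpNorm_fderiv_of_le volume hφ hsupp hp (by simpa using hpd)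
          (by simpa using hpq) hΩb
    _ ≤ S * eLpNorm (jacobian φ) p volume := by
        gcongr
        exact eLpNorm_mono (norm_fderiv_le_norm_jacobian φ)
    _ = S * eLpNorm (jacobian φ) p (volume.restrict Ω) := by
        rw [eLpNorm_restrict_eq_of_support_subset hsupp']
    _ ≤ S * (eLpNorm (jacobian φ) r (volume.restrict Ω) * m) := by
        gcongr
        exact eLpNorm_le_eLpNorm_mul_rpow_measure_univ (by exact_mod_cast hpr)
          (continuous_jacobian hφ).aestronglyMeasurable
    _ = _ := by rw [ENNReal.coe_mul, ENNReal.coe_toNNReal hm_ne_top]; ring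

/-- `K` is a constant in the Sobolev inequality `‖v‖_{L^q} ≤ K ‖∇v‖` on `X`; for `q = 2` this is
the Poincaré–Friedrichs inequality. -/
def IsSobolevConst {d : ℕ} (Ω : Set (Vec d)) (q : ℝ≥0∞) (K : ℝ≥0) : Prop :=
  ∀ v : H10 Ω, eLpNorm (vel v) q (volume.restrict Ω) ≤ K * ‖grad v‖ₑ

theorem isSobolevConst_of_forall_contDiff {d : ℕ} {Ω : Set (Vec d)} {q : ℝ≥0∞} {K : ℝ≥0}
    (hK : ∀ φ : Vec d → Vec d, ContDiff ℝ ∞ φ → tsupport φ ⊆ Ω →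
      eLpNorm φ q (volume.restrict Ω) ≤ K * eLpNorm (jacobian φ) 2 (volume.restrict Ω)) :
    IsSobolevConst Ω q K := by
  intro v
  obtain ⟨P, hP, hlim⟩ := mem_closure_iff_seq_limit.1 v.2
  have vel_lim : Tendsto (fun n => (P n).1) atTop (𝓝 (vel v)) :=
    (continuous_fst.tendsto _).comp hlim
  have grad_lim : Tendsto (fun n => (P n).2) atTop (𝓝 (grad v)) :=
    (continuous_snd.tendsto _).comp hlim
  obtain ⟨s, hs, hae⟩ := (tendstoInMeasure_of_tendsto_Lp vel_lim).exists_seq_tendsto_ae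
  have bound (n : ℕ) : eLpNorm (P n).1 q (volume.restrict Ω) ≤ K * ‖(P n).2‖ₑ := by
    obtain ⟨φ, hφ, -, hsupp, hvel, hgrad⟩ := hP n
    rw [Lp.enorm_def, eLpNorm_congr_ae hvel, eLpNorm_congr_ae hgrad]
    exact hK φ hφ hsupp
  have bound_lim : Tendsto (fun n => K * ‖(P (s n)).2‖ₑ) atTop (𝓝 (K * ‖grad v‖ₑ)) :=
    ENNReal.Tendsto.const_mul
      ((continuous_enorm.tendsto _).comp (grad_lim.comp hs.tendsto_atTop))
      (Or.inr ENNReal.coe_ne_top)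
  calc eLpNorm (vel v) q (volume.restrict Ω)
      ≤ liminf (fun n => eLpNorm (P (s n)).1 q (volume.restrict Ω)) atTop :=
        Lp.eLpNorm_lim_le_liminf_eLpNorm (fun n => Lp.aestronglyMeasurable (P (s n)).1) _ hae
    _ ≤ liminf (fun n => K * ‖(P (s n)).2‖ₑ) atTop :=
        liminf_le_liminf (Eventually.of_forall fun n => bound (s n))
    _ = K * ‖grad v‖ₑ := bound_lim.liminf_eq

theorem exists_isSobolevConst {d : ℕ} (hd : d = 2 ∨ d = 3) {Ω : Set (Vec d)}
    (hΩb : Bornology.IsBounded Ω) {q : ℝ≥0∞} (hq : 0 < q) (hq6 : q ≤ 6) :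
    ∃ K : ℝ≥0, IsSobolevConst Ω q K := by
  lift q to ℝ≥0 using ne_top_of_le_ne_top (by simp) hq6
  obtain ⟨p, hp1, hp2, hpd, hp6⟩ : ∃ p : ℝ≥0, (1 : ℝ) ≤ p ∧ (p : ℝ) ≤ 2 ∧ (p : ℝ) < d ∧
      (p : ℝ)⁻¹ - (d : ℝ)⁻¹ ≤ (6 : ℝ)⁻¹ := by
    rcases hd with rfl | rfl
    · exact ⟨3 / 2, by norm_num⟩
    · exact ⟨2, by norm_num⟩
  have hpq : (p : ℝ)⁻¹ - (d : ℝ)⁻¹ ≤ (q : ℝ)⁻¹ :=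
    hp6.trans (inv_anti₀ (by exact_mod_cast hq) (by exact_mod_cast hq6))
  obtain ⟨K, hK⟩ := exists_eLpNorm_le_eLpNorm_jacobian hΩb
    (by exact_mod_cast hp1) (by exact_mod_cast hpd) hpq (r := 2) (by exact_mod_cast hp2)
  exact ⟨K, isSobolevConst_of_forall_contDiff fun φ hφ => hK φ (hφ.of_le (by simp))⟩

section Trilinear

variable {d : ℕ} {Ω : Set (Vec d)} {q r : ℝ≥0∞} {K K' : ℝ≥0}

theorem vel_add (v w : H10 Ω) : vel (v + w) = vel v + vel w := rfl

theorem vel_sub (v w : H10 Ω) : vel (v - w) = vel v - vel w := rfl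

theorem vel_smul (c : ℝ) (v : H10 Ω) : vel (c • v) = c • vel v := rfl

theorem IsSobolevConst.memLp (hK : IsSobolevConst Ω q K) (v : H10 Ω) :
    MemLp (vel v) q (volume.restrict Ω) :=
  ⟨Lp.aestronglyMeasurable _, (hK v).trans_lt (by finiteness)⟩

theorem IsSobolevConst.toReal_eLpNorm_le (hK : IsSobolevConst Ω q K) (v : H10 Ω) :
    (eLpNorm (vel v) q (volume.restrict Ω)).toReal ≤ K * ‖grad v‖ := by
  simpa using ENNReal.toReal_mono (by finiteness) (hK v)

theorem IsSobolevConst.sqrt_interpolation (h₆ : IsSobolevConst Ω 6 K) (v : H10 Ω) :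
    (eLpNorm (vel v) 3 (volume.restrict Ω)).toReal ≤ √K * √(‖grad v‖ * ‖vel v‖) := by
  have interpolation : eLpNorm (vel v) 3 (volume.restrict Ω) ≤
      (K * ‖grad v‖ₑ) ^ (1 / 2 : ℝ) * ‖vel v‖ₑ ^ (1 / 2 : ℝ) := by
    rw [Lp.enorm_def (vel v)]
    refine (eLpNorm_three_le (Lp.aestronglyMeasurable _)).trans ?_
    gcongr
    exact h₆ v
  have := ENNReal.toReal_mono (by finiteness) interpolation
  simpa [← ENNReal.toReal_rpow, ← Real.sqrt_eq_rpow, mul_assoc, Real.sqrt_mul, -one_div] using this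

/-- The embedding of `X` into `L^q(Ω)^d` given by Sobolev's inequality. -/
def IsSobolevConst.velLp [Fact (1 ≤ q)] (hK : IsSobolevConst Ω q K) :
    H10 Ω →L[ℝ] Lp (Vec d) q (volume.restrict Ω) :=
  LinearMap.mkContinuous
    { toFun := fun v => (hK.memLp v).toLp (vel v)
      map_add' := fun v w =>
        (MemLp.toLp_congr _ ((hK.memLp v).add (hK.memLp w)) (by
          rw [vel_add]
          exact Lp.coeFn_add _ _)).trans (MemLp.toLp_add _ _)
      map_smul' := fun c v =>
        (MemLp.toLp_congr _ ((hK.memLp v).const_smul c) (by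
          rw [vel_smul]
          exact Lp.coeFn_smul _ _)).trans (MemLp.toLp_const_smul _ _) }
    K fun v => by
      refine (Lp.norm_toLp _ (hK.memLp v)).trans_le ((hK.toReal_eLpNorm_le v).trans ?_)
      gcongr
      exact norm_snd_le v.1

theorem IsSobolevConst.velLp_ae_eq [Fact (1 ≤ q)] (hK : IsSobolevConst Ω q K) (v : H10 Ω) :
    hK.velLp v =ᵐ[volume.restrict Ω] vel v :=
  (hK.memLp v).coeFn_toLp

theorem IsSobolevConst.norm_velLp [Fact (1 ≤ q)] (hK : IsSobolevConst Ω q K) (v : H10 Ω) :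
    ‖hK.velLp v‖ = (eLpNorm (vel v) q (volume.restrict Ω)).toReal :=
  Lp.norm_toLp _ (hK.memLp v)

/-- The bilinear map `(a, c) ↦ c ⊗ a` on vectors: pairing `∇v` with `w ⊗ u` gives
`(u·∇v)·w`. -/
def outer (d : ℕ) : Vec d →L[ℝ] Vec d →L[ℝ] Tens d :=
  (LinearMap.mk₂ ℝ (fun a c : Vec d => (WithLp.toLp 2 fun ik => a ik.2 * c ik.1 : Tens d))
    (fun _ _ _ => by ext; simp [add_mul]) (fun _ _ _ => by ext; simp [mul_assoc])
    (fun _ _ _ => by ext; simp [mul_add])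
    (fun _ _ _ => by ext; simp [mul_left_comm])).toContinuousBilinearMap

/-- The bilinear map `(a, c) ↦ (a·c) I` on vectors: pairing `∇u` with it gives
`(a·c) ∇·u`. -/
def innerId (d : ℕ) : Vec d →L[ℝ] Vec d →L[ℝ] Tens d :=
  (LinearMap.mk₂ ℝ (fun a c : Vec d =>
      inner ℝ a c • (WithLp.toLp 2 fun ik => if ik.1 = ik.2 then 1 else 0 : Tens d))
    (fun _ _ _ => by rw [inner_add_left, add_smul])
    (fun _ _ _ => by rw [real_inner_smul_left, mul_smul])
    (fun _ _ _ => by rw [inner_add_right, add_smul])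
    (fun _ _ _ => by rw [real_inner_smul_right, mul_smul])).toContinuousBilinearMap

theorem inner_outer (a c : Vec d) (T : Tens d) :
    inner ℝ T (outer d a c) = ∑ i, ∑ k, a k * T (i, k) * c i := by
  simp only [PiLp.inner_apply, Fintype.sum_prod_type, outer]
  refine Finset.sum_congr rfl fun i _ => Finset.sum_congr rfl fun k _ => ?_
  simp
  ring

theorem inner_jacobian_outer (φ : Vec d → Vec d) (x a c : Vec d) :
    inner ℝ (jacobian φ x) (outer d a c) = inner ℝ (fderiv ℝ φ x a) c := by
  rw [inner_outer, PiLp.inner_apply]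
  simp only [fderiv_apply_eq_sum_jacobian, RCLike.inner_apply, conj_trivial, Finset.mul_sum]
  exact Finset.sum_congr rfl fun i _ => Finset.sum_congr rfl fun k _ => by ring

theorem inner_innerId (a c : Vec d) (T : Tens d) :
    inner ℝ T (innerId d a c) = inner ℝ a c * ∑ i, T (i, i) := by
  simp only [PiLp.inner_apply, Fintype.sum_prod_type, innerId]
  simp [Finset.mul_sum]

/-- The trilinear form `∫_Ω ∇v : B(u, w)` on `X` attached to a bilinear map `B`. -/
def triForm [Fact (1 ≤ q)] [Fact (1 ≤ r)] [ENNReal.HolderTriple q r 2]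
    (hK : IsSobolevConst Ω q K) (hK' : IsSobolevConst Ω r K') (B : Vec d →L[ℝ] Vec d →L[ℝ] Tens d)
    (u v w : H10 Ω) : ℝ :=
  inner ℝ (grad v) (B.holderL (volume.restrict Ω) q r 2 (hK.velLp u) (hK'.velLp w))

variable [Fact (1 ≤ q)] [Fact (1 ≤ r)] [ENNReal.HolderTriple q r 2]
    (hK : IsSobolevConst Ω q K) (hK' : IsSobolevConst Ω r K')
    (B : Vec d →L[ℝ] Vec d →L[ℝ] Tens d)

theorem triForm_eq_setIntegral (u v w : H10 Ω) :
    triForm hK hK' B u v w = ∫ x in Ω, inner ℝ (grad v x) (B (vel u x) (vel w x)) := by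
  rw [triForm, L2.inner_def]
  refine integral_congr_ae ?_
  filter_upwards [B.coeFn_holder (r := 2) (hK.velLp u) (hK'.velLp w), hK.velLp_ae_eq u,
    hK'.velLp_ae_eq w] with x hB hu hw
  rw [ContinuousLinearMap.holderL_apply_apply, hB, hu, hw]

theorem convect_eq_triForm (u v w : H10 Ω) : convect u v w = triForm hK hK' (outer d) u v w := by
  simp only [triForm_eq_setIntegral, inner_outer, convect]

theorem abs_triForm_le (u v w : H10 Ω) :
    |triForm hK hK' B u v w| ≤ ‖B‖ * ‖hK.velLp u‖ * ‖hK'.velLp w‖ * ‖grad v‖ := by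
  rw [triForm, mul_comm _ ‖grad v‖]
  refine (abs_real_inner_le_norm _ _).trans ?_
  gcongr
  exact B.norm_holder_apply_apply_le _ _

theorem continuous_triForm_comp {α : Type*} [TopologicalSpace α] {u v w : α → H10 Ω}
    (hu : Continuous u) (hv : Continuous v) (hw : Continuous w) :
    Continuous fun x => triForm hK hK' B (u x) (v x) (w x) := by
  unfold triForm grad
  fun_prop

theorem triForm_sub_right (u v w w' : H10 Ω) :
    triForm hK hK' B u v (w - w') = triForm hK hK' B u v w - triForm hK hK' B u v w' := by
  simp only [triForm, map_sub, inner_sub_right]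

end Trilinear

theorem hasCompactSupport_jacobian {d : ℕ} {φ : Vec d → Vec d} (hφ : HasCompactSupport φ) :
    HasCompactSupport (jacobian φ) :=
  hφ.mono' (support_jacobian_subset φ)

section TestFields

variable {d : ℕ} {φ ψ χ : Vec d → Vec d}

theorem integrable_inner_jacobian (B : Vec d →L[ℝ] Vec d →L[ℝ] Tens d) (hφ : Continuous φ)
    (hψ : ContDiff ℝ 1 ψ) (hψc : HasCompactSupport ψ) (hχ : Continuous χ) :
    Integrable fun x => inner ℝ (jacobian ψ x) (B (φ x) (χ x)) := by
  have hJ : Continuous (jacobian ψ) := continuous_jacobian hψ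
  refine Continuous.integrable_of_hasCompactSupport (by fun_prop) ?_
  refine (hasCompactSupport_jacobian hψc).mono fun x hx => ?_
  contrapose! hx
  simp [Function.notMem_support.1 hx]

theorem integral_inner_jacobian_outer_add (hφ : ContDiff ℝ 1 φ) (hφc : HasCompactSupport φ)
    (hψ : ContDiff ℝ 1 ψ) (hψc : HasCompactSupport ψ) (hχ : ContDiff ℝ 1 χ)
    (hχc : HasCompactSupport χ) :
    (∫ x, inner ℝ (jacobian ψ x) (outer d (φ x) (χ x)))
      + (∫ x, inner ℝ (jacobian χ x) (outer d (φ x) (ψ x)))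
      + ∫ x, inner ℝ (jacobian φ x) (innerId d (ψ x) (χ x)) = 0 := by
  have int₁ := integrable_inner_jacobian (outer d) hφ.continuous hψ hψc hχ.continuous
  have int₂ := integrable_inner_jacobian (outer d) hφ.continuous hχ hχc hψ.continuous
  have int₃ := integrable_inner_jacobian (innerId d) hψ.continuous hφ hφc hχ.continuous
  rw [← integral_add' int₁ int₂, ← integral_add' (int₁.add int₂) int₃,
    ← integral_fderiv_apply_add_mul_div_eq_zero (hψ.inner ℝ hχ) hφ hφc]
  refine integral_congr_ae (.of_forall fun x => ?_)
  simp only [Pi.add_apply, inner_jacobian_outer, inner_innerId]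
  rw [fderiv_inner_apply ℝ (hψ.differentiable one_ne_zero x) (hχ.differentiable one_ne_zero x),
    real_inner_comm (ψ x) (fderiv ℝ χ x (φ x)), add_comm (inner ℝ (fderiv ℝ ψ x (φ x)) (χ x))]

end TestFields

/-- The elements of `X` that are classical compactly supported fields, of class `C¹`. -/
def testFields {d : ℕ} (Ω : Set (Vec d)) : Set (H10 Ω) :=
  {v | ∃ φ : Vec d → Vec d, ContDiff ℝ 1 φ ∧ HasCompactSupport φ ∧ tsupport φ ⊆ Ω ∧
    vel v =ᵐ[volume.restrict Ω] φ ∧ grad v =ᵐ[volume.restrict Ω] jacobian φ}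

theorem dense_testFields {d : ℕ} (Ω : Set (Vec d)) : Dense (testFields Ω) := by
  refine ((denseRange_inclusion_iff (testPairs Ω).le_topologicalClosure).2 subset_rfl).mono ?_
  rintro _ ⟨⟨P, φ, hφ, hφ'⟩, rfl⟩
  exact ⟨φ, hφ.of_le (by simp), hφ'⟩

section Trilinear

variable {d : ℕ} {Ω : Set (Vec d)} {q r : ℝ≥0∞} {K K' : ℝ≥0}
  [Fact (1 ≤ q)] [Fact (1 ≤ r)] [ENNReal.HolderTriple q r 2]

theorem triForm_eq_integral (hK : IsSobolevConst Ω q K) (hK' : IsSobolevConst Ω r K')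
    (B : Vec d →L[ℝ] Vec d →L[ℝ] Tens d) {u v w : H10 Ω} {φ ψ χ : Vec d → Vec d}
    (hψ : tsupport ψ ⊆ Ω) (hu : vel u =ᵐ[volume.restrict Ω] φ)
    (hv : grad v =ᵐ[volume.restrict Ω] jacobian ψ) (hw : vel w =ᵐ[volume.restrict Ω] χ) :
    triForm hK hK' B u v w = ∫ x, inner ℝ (jacobian ψ x) (B (φ x) (χ x)) := by
  rw [triForm_eq_setIntegral]
  calc ∫ x in Ω, inner ℝ (grad v x) (B (vel u x) (vel w x))
      = ∫ x in Ω, inner ℝ (jacobian ψ x) (B (φ x) (χ x)) := by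
        refine integral_congr_ae ?_
        filter_upwards [hu, hv, hw] with x hux hvx hwx
        rw [hux, hvx, hwx]
    _ = ∫ x, inner ℝ (jacobian ψ x) (B (φ x) (χ x)) := by
        refine setIntegral_eq_integral_of_forall_compl_eq_zero fun x hx => ?_
        have : jacobian ψ x = 0 := Function.support_subset_iff'.1
          ((support_jacobian_subset ψ).trans hψ) x hx
        rw [this, inner_zero_left]

theorem triForm_outer_add_triForm_outer_add_triForm_innerId (hK : IsSobolevConst Ω q K)
    (hK' : IsSobolevConst Ω r K') (u v w : H10 Ω) :
    triForm hK hK' (outer d) u v w + triForm hK hK' (outer d) u w v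
      + triForm hK hK' (innerId d) v u w = 0 := by
  have on_testFields {u v w : H10 Ω} (hu : u ∈ testFields Ω) (hv : v ∈ testFields Ω)
      (hw : w ∈ testFields Ω) : triForm hK hK' (outer d) u v w + triForm hK hK' (outer d) u w v
        + triForm hK hK' (innerId d) v u w = 0 := by
    obtain ⟨φ, hφ, hφc, hφΩ, hu, hu'⟩ := hu
    obtain ⟨ψ, hψ, hψc, hψΩ, hv, hv'⟩ := hv
    obtain ⟨χ, hχ, hχc, hχΩ, hw, hw'⟩ := hw
    rw [triForm_eq_integral hK hK' _ hψΩ hu hv' hw, triForm_eq_integral hK hK' _ hχΩ hu hw' hv,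
      triForm_eq_integral hK hK' _ hφΩ hv hu' hw]
    exact integral_inner_jacobian_outer_add hφ hφc hψ hψc hχ hχc
  refine (dense_testFields Ω).denseRange_val.induction_on₃
    (p := fun u v w => triForm hK hK' (outer d) u v w + triForm hK hK' (outer d) u w v
      + triForm hK hK' (innerId d) v u w = 0) ?_ (fun u v w => on_testFields u.2 v.2 w.2) u v w
  have cont₁ : Continuous fun z : H10 Ω × H10 Ω × H10 Ω => z.1 := by fun_prop
  have cont₂ : Continuous fun z : H10 Ω × H10 Ω × H10 Ω => z.2.1 := by fun_prop
  have cont₃ : Continuous fun z : H10 Ω × H10 Ω × H10 Ω => z.2.2 := by fun_prop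
  exact isClosed_eq (((continuous_triForm_comp hK hK' (outer d) cont₁ cont₂ cont₃).add
    (continuous_triForm_comp hK hK' (outer d) cont₁ cont₃ cont₂)).add
    (continuous_triForm_comp hK hK' (innerId d) cont₂ cont₁ cont₃)) continuous_const

theorem bStar_eq_triForm (hK : IsSobolevConst Ω q K) (hK' : IsSobolevConst Ω r K')
    (u w v : H10 Ω) :
    bStar u w v = -(triForm hK hK' (outer d) u v w + 1 / 2 * triForm hK hK' (innerId d) v u w) := by
  rw [bStar, convect_eq_triForm hK hK', convect_eq_triForm hK hK']
  linarith [triForm_outer_add_triForm_outer_add_triForm_innerId hK hK' u v w]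

theorem bStar_self (u v : H10 Ω) : bStar u v v = 0 :=
  sub_self _

theorem bStar_sub_mid (hK : IsSobolevConst Ω q K) (hK' : IsSobolevConst Ω r K')
    (u w w' v : H10 Ω) : bStar u (w - w') v = bStar u w v - bStar u w' v := by
  simp only [bStar_eq_triForm hK hK', triForm_sub_right]
  ring

instance : Fact ((1 : ℝ≥0∞) ≤ 3) := ⟨by norm_num⟩

instance : Fact ((1 : ℝ≥0∞) ≤ 6) := ⟨by norm_num⟩

instance : ENNReal.HolderTriple 6 3 2 := by
  constructor
  rw [← ENNReal.toReal_eq_toReal_iff' (by simp) (by simp), ENNReal.toReal_add (by simp) (by simp)]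
  norm_num

/-- The constant `M` in `|b*(u, w, v)| ≤ M ‖∇u‖ ‖∇v‖ ‖∇w‖^{1/2} ‖w‖^{1/2}`, where `K` is a Sobolev
constant for the exponent `6`. -/
def bStarConst (d : ℕ) (K : ℝ≥0) : ℝ :=
  (‖outer d‖ + 1 / 2 * ‖innerId d‖) * (K * √K)

theorem abs_bStar_le (h₆ : IsSobolevConst Ω 6 K) (h₃ : IsSobolevConst Ω 3 K') (u w v : H10 Ω) :
    |bStar u w v| ≤ bStarConst d K * (‖grad u‖ * ‖grad v‖ * √(‖grad w‖ * ‖vel w‖)) := by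
  have norm₆ (z : H10 Ω) : ‖h₆.velLp z‖ ≤ K * ‖grad z‖ :=
    (h₆.norm_velLp z).trans_le (h₆.toReal_eLpNorm_le z)
  have norm₃ : ‖h₃.velLp w‖ ≤ √K * √(‖grad w‖ * ‖vel w‖) :=
    (h₃.norm_velLp w).trans_le (h₆.sqrt_interpolation w)
  have triForm_le (B : Vec d →L[ℝ] Vec d →L[ℝ] Tens d) (y z : H10 Ω) :
      |triForm h₆ h₃ B y z w| ≤ ‖B‖ * (K * ‖grad y‖) * (√K * √(‖grad w‖ * ‖vel w‖)) * ‖grad z‖ := by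
    refine (abs_triForm_le h₆ h₃ B y z w).trans ?_
    gcongr
    exact norm₆ y
  calc |bStar u w v|
      = |triForm h₆ h₃ (outer d) u v w + 1 / 2 * triForm h₆ h₃ (innerId d) v u w| := by
        rw [bStar_eq_triForm h₆ h₃, abs_neg]
    _ ≤ |triForm h₆ h₃ (outer d) u v w| + 1 / 2 * |triForm h₆ h₃ (innerId d) v u w| := by
        refine (abs_add_le _ _).trans_eq ?_
        rw [abs_mul, abs_of_pos (by norm_num : (0 : ℝ) < 1 / 2)]
    _ ≤ _ := add_le_add (triForm_le _ _ _)
        (mul_le_mul_of_nonneg_left (triForm_le _ _ _) (by norm_num))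
    _ = _ := by rw [bStarConst]; ring

end Trilinear

section DualNorm

variable {d : ℕ} {Ω : Set (Vec d)} {K : ℝ≥0}

theorem IsSobolevConst.norm_le (hK : IsSobolevConst Ω 2 K) (v : H10 Ω) :
    ‖v‖ ≤ max K 1 * ‖grad v‖ := by
  refine max_le ?_ ?_
  · calc ‖vel v‖ ≤ K * ‖grad v‖ := hK.toReal_eLpNorm_le v
      _ ≤ max K 1 * ‖grad v‖ := by gcongr; exact le_max_left _ _
  · exact le_mul_of_one_le_left (norm_nonneg (grad v)) (le_max_right _ _)

theorem apply_le_negNorm_mul (hK : IsSobolevConst Ω 2 K) (f : H10 Ω →L[ℝ] ℝ) (v : H10 Ω) :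
    f v ≤ negNorm f * ‖grad v‖ := by
  have grad_pos {w : H10 Ω} (hw : w ≠ 0) : 0 < ‖grad w‖ := by
    refine (norm_nonneg _).lt_of_ne' fun h => hw (norm_le_zero_iff.1 ?_)
    simpa [h] using hK.norm_le w
  rcases eq_or_ne v 0 with rfl | hv
  · simp [grad]
  · rw [← div_le_iff₀ (grad_pos hv)]
    refine le_ciSup (f := fun v : {v : H10 Ω // v ≠ 0} => f v.1 / ‖grad v.1‖)
      ⟨‖f‖ * max K 1, ?_⟩ ⟨v, hv⟩
    rintro _ ⟨⟨w, hw⟩, rfl⟩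
    refine (div_le_iff₀ (grad_pos hw)).2 ?_
    calc f w ≤ ‖f‖ * ‖w‖ := (le_abs_self _).trans (f.le_opNorm w)
      _ ≤ ‖f‖ * (max K 1 * ‖grad w‖) := by gcongr; exact hK.norm_le w
      _ = ‖f‖ * max K 1 * ‖grad w‖ := by ring

theorem mul_apply_le (hK : IsSobolevConst Ω 2 K) {ν τ : ℝ} (hν : 0 < ν) (hτ : 0 < τ)
    (f : H10 Ω →L[ℝ] ℝ) (v : H10 Ω) :
    τ * f v ≤ τ / ν * negNorm f ^ 2 + τ / 4 * (ν * ‖grad v‖ ^ 2) := by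
  have sq_nonneg : 0 ≤ τ / ν * (negNorm f - ν / 2 * ‖grad v‖) ^ 2 := by positivity
  calc τ * f v ≤ τ * (negNorm f * ‖grad v‖) := by gcongr; exact apply_le_negNorm_mul hK f v
    _ = τ / ν * negNorm f ^ 2 + τ / 4 * (ν * ‖grad v‖ ^ 2)
        - τ / ν * (negNorm f - ν / 2 * ‖grad v‖) ^ 2 := by field_simp; ring
    _ ≤ _ := sub_le_self _ sq_nonneg

end DualNorm

section Scheme

theorem inner_blended_eq {H : Type*} [NormedAddCommGroup H] [InnerProductSpace ℝ H]
    (a b c e : H) :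
    1 / 6 * inner ℝ ((10 : ℝ) • a - (15 : ℝ) • b + (6 : ℝ) • c - e) a =
      1 / 12 * ‖a‖ ^ 2 + 1 / 12 * ‖(3 : ℝ) • a - b‖ ^ 2
        + 1 / 12 * ‖(3 : ℝ) • a - (3 : ℝ) • b + c‖ ^ 2
      - (1 / 12 * ‖b‖ ^ 2 + 1 / 12 * ‖(3 : ℝ) • b - c‖ ^ 2
        + 1 / 12 * ‖(3 : ℝ) • b - (3 : ℝ) • c + e‖ ^ 2)
      + 1 / 12 * ‖a - (3 : ℝ) • b + (3 : ℝ) • c - e‖ ^ 2 := by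
  simp only [← real_inner_self_eq_norm_sq, inner_add_left, inner_add_right, inner_sub_left,
    inner_sub_right, real_inner_smul_left, real_inner_smul_right, real_inner_comm a b,
    real_inner_comm a c, real_inner_comm a e, real_inner_comm b c, real_inner_comm b e,
    real_inner_comm c e]
  ring

variable {d : ℕ} {Ω : Set (Vec d)}

/-- The `G`-norm energy of the blended BDF scheme at time level `n ≥ 2`. -/
def energy (w : ℕ → H10 Ω) (n : ℕ) : ℝ :=
  1 / 12 * ‖vel (w n)‖ ^ 2 + 1 / 12 * ‖vel ((3 : ℝ) • w n - w (n - 1))‖ ^ 2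
    + 1 / 12 * ‖vel ((3 : ℝ) • w n - (3 : ℝ) • w (n - 1) + w (n - 2))‖ ^ 2

/-- The third difference `wⁿ⁺¹ - 3wⁿ + 3wⁿ⁻¹ - wⁿ⁻²` (for `n ≥ 2`), whose norm measures the
numerical dissipation. -/
def thirdDiff (w : ℕ → H10 Ω) (n : ℕ) : H10 Ω :=
  w (n + 1) - (3 : ℝ) • w n + (3 : ℝ) • w (n - 1) - w (n - 2)

theorem extrap_eq_sub_thirdDiff (w : ℕ → H10 Ω) (n : ℕ) :
    extrap w n = w (n + 1) - thirdDiff w n := by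
  rw [extrap, thirdDiff]
  abel

theorem mul_inner_blendedBDF_eq {τ : ℝ} (hτ : τ ≠ 0) (w : ℕ → H10 Ω) (n : ℕ) :
    τ * inner ℝ (vel (blendedBDF τ w n)) (vel (w (n + 1))) =
      energy w (n + 1) - energy w n + 1 / 12 * ‖vel (thirdDiff w n)‖ ^ 2 := by
  have pred_pred : n + 1 - 2 = n - 1 := rfl
  simp only [energy, blendedBDF, thirdDiff, vel_add, vel_sub, vel_smul, Nat.add_sub_cancel,
    pred_pred]
  rw [← inner_blended_eq, real_inner_smul_left]
  field_simp

variable {J NT : ℕ} {Xh : Submodule ℝ (H10 Ω)} {Qh : Submodule ℝ (L2 Ω ℝ)} {ν τ : ℝ}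
  {f : Fin J → ℕ → (H10 Ω →L[ℝ] ℝ)} {u : Fin J → ℕ → H10 Ω} {p : Fin J → ℕ → L2 Ω ℝ}

theorem IsSchemeSolution.thirdDiff_mem (hsol : IsSchemeSolution Xh Qh ν τ f NT u p) (j : Fin J)
    {n : ℕ} (hn : n < NT) : thirdDiff (u j) n ∈ Xh := by
  have mem {k : ℕ} (hk : k ≤ n + 1) : u j k ∈ Xh := hsol.vel_mem j k (by lia)
  exact Xh.sub_mem (Xh.add_mem (Xh.sub_mem (mem le_rfl) (Xh.smul_mem _ (mem (by lia))))
    (Xh.smul_mem _ (mem (by lia)))) (mem (by lia))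

theorem IsSchemeSolution.momentum_self {K₃ K₆ : ℝ≥0} (h₃ : IsSobolevConst Ω 3 K₃)
    (h₆ : IsSobolevConst Ω 6 K₆) (hsol : IsSchemeSolution Xh Qh ν τ f NT u p) (j : Fin J) {n : ℕ}
    (hn : 2 ≤ n) (hnN : n < NT) :
    inner ℝ (vel (blendedBDF τ (u j) n)) (vel (u j (n + 1))) + ν * ‖grad (u j (n + 1))‖ ^ 2 =
      f j (n + 1) (u j (n + 1)) + bStar (fluct u j n) (thirdDiff (u j) n) (u j (n + 1)) := by
  have momentum := hsol.momentum j n hn hnN _ (hsol.vel_mem j _ hnN)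
  have pressure : inner ℝ (p j (n + 1)) (div (u j (n + 1))) = 0 :=
    (real_inner_comm _ _).trans (hsol.mass j n hn hnN _ (hsol.pres_mem j n hn hnN))
  rw [bStar_self, extrap_eq_sub_thirdDiff, bStar_sub_mid h₆ h₃, bStar_self, pressure,
    real_inner_self_eq_norm_sq] at momentum
  linarith

theorem IsSchemeSolution.energy_succ_le {K₂ K₃ K₆ : ℝ≥0} (h₂ : IsSobolevConst Ω 2 K₂)
    (h₃ : IsSobolevConst Ω 3 K₃) (h₆ : IsSobolevConst Ω 6 K₆)
    (hsol : IsSchemeSolution Xh Qh ν τ f NT u p) (hν : 0 < ν) (hτ : 0 < τ) {h Cinv : ℝ}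
    (hh : 0 < h) (hinv : ∀ v ∈ Xh, h * ‖grad v‖ ≤ Cinv * ‖vel v‖) {j : Fin J} {n : ℕ} (hn : 2 ≤ n)
    (hnN : n < NT)
    (hfluct : 24 * bStarConst d K₆ ^ 2 * Cinv * (τ / (ν * h)) * ‖grad (fluct u j n)‖ ^ 2 ≤ 1) :
    energy (u j) (n + 1)
        + (1 / 24 * ‖vel (thirdDiff (u j) n)‖ ^ 2 + τ / 4 * (ν * ‖grad (u j (n + 1))‖ ^ 2))
      ≤ τ / ν * negNorm (f j (n + 1)) ^ 2 + energy (u j) n := by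
  have balance := congrArg (τ * ·) (hsol.momentum_self h₃ h₆ j hn hnN)
  simp only [mul_add, mul_inner_blendedBDF_eq hτ.ne'] at balance
  have force := mul_apply_le h₂ hν hτ (f j (n + 1)) (u j (n + 1))
  have convection := mul_abs_le_of_abs_le_mul_sqrt hh hν hτ (norm_nonneg _) (norm_nonneg _)
    (abs_bStar_le h₆ h₃ (fluct u j n) (thirdDiff (u j) n) (u j (n + 1)))
    (hinv _ (hsol.thirdDiff_mem j hnN)) hfluct
  have convection_le := mul_le_mul_of_nonneg_left
    (le_abs_self (bStar (fluct u j n) (thirdDiff (u j) n) (u j (n + 1)))) hτ.le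
  have dissipation_nonneg : 0 ≤ τ * (ν * ‖grad (u j (n + 1))‖ ^ 2) := by positivity
  linarith

theorem IsSchemeSolution.energy_add_sum_le {K₂ K₃ K₆ : ℝ≥0} (h₂ : IsSobolevConst Ω 2 K₂)
    (h₃ : IsSobolevConst Ω 3 K₃) (h₆ : IsSobolevConst Ω 6 K₆)
    (hsol : IsSchemeSolution Xh Qh ν τ f NT u p) (hν : 0 < ν) (hτ : 0 < τ) {h Cinv : ℝ}
    (hh : 0 < h) (hinv : ∀ v ∈ Xh, h * ‖grad v‖ ≤ Cinv * ‖vel v‖) {j : Fin J} {N : ℕ} (hN : 2 ≤ N)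
    (hNT : N ≤ NT) (hfluct : ∀ n, 2 ≤ n → n < N →
      24 * bStarConst d K₆ ^ 2 * Cinv * (τ / (ν * h)) * ‖grad (fluct u j n)‖ ^ 2 ≤ 1) :
    energy (u j) N + 1 / 24 * (∑ n ∈ Finset.Ico 2 N, ‖vel (thirdDiff (u j) n)‖ ^ 2)
        + τ / 4 * (∑ n ∈ Finset.Ico 2 N, ν * ‖grad (u j (n + 1))‖ ^ 2)
      ≤ ∑ n ∈ Finset.Ico 2 N, τ / ν * negNorm (f j (n + 1)) ^ 2 + energy (u j) 2 := by
  rw [Finset.mul_sum, Finset.mul_sum, add_assoc, ← Finset.sum_add_distrib]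
  refine add_sum_le_sum_add_of_step hN fun n hn => ?_
  obtain ⟨hn, hnN⟩ := Finset.mem_Ico.1 hn
  exact hsol.energy_succ_le h₂ h₃ h₆ hν hτ hh hinv hn (hnN.trans_le hNT) (hfluct n hn hnN)

end Scheme

end EnBlended

end

theorem theorem1_general {d : ℕ} (hd : d = 2 ∨ d = 3) (Ω : Set (EnBlended.Vec d))
    (hΩb : Bornology.IsBounded Ω) (Cinv : ℝ) (hCinv : 0 < Cinv) :
    ∃ C : ℝ, 0 < C ∧
      ∀ (h : ℝ) (_ : 0 < h)
        (Xh : Submodule ℝ (EnBlended.H10 Ω)) (Qh : Submodule ℝ (EnBlended.L2 Ω ℝ))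
        (_ : ∀ v ∈ Xh, h * ‖EnBlended.grad v‖ ≤ Cinv * ‖EnBlended.vel v‖)
        (ν Δt : ℝ) (_ : 0 < ν) (_ : 0 < Δt) (J NT : ℕ)
        (f : Fin J → ℕ → (EnBlended.H10 Ω →L[ℝ] ℝ))
        (u : Fin J → ℕ → EnBlended.H10 Ω) (p : Fin J → ℕ → EnBlended.L2 Ω ℝ)
        (_ : EnBlended.IsSchemeSolution Xh Qh ν Δt f NT u p)
        (_ : ∀ j n, 2 ≤ n → n < NT →
          C * (Δt / (ν * h)) * ‖EnBlended.grad (EnBlended.fluct u j n)‖ ^ 2 ≤ 1)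
        (j : Fin J) (N : ℕ) (_ : 2 < N) (_ : N ≤ NT),
        1 / 12 * ‖EnBlended.vel (u j N)‖ ^ 2
          + 1 / 12 * ‖EnBlended.vel ((3 : ℝ) • u j N - u j (N - 1))‖ ^ 2
          + 1 / 12 * ‖EnBlended.vel
              ((3 : ℝ) • u j N - (3 : ℝ) • u j (N - 1) + u j (N - 2))‖ ^ 2
          + 1 / 24 * (∑ n ∈ Finset.Icc 2 (N - 1), ‖EnBlended.vel
              (u j (n + 1) - (3 : ℝ) • u j n + (3 : ℝ) • u j (n - 1) - u j (n - 2))‖ ^ 2)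
          + Δt / 4 * (∑ n ∈ Finset.Icc 2 (N - 1), ν * ‖EnBlended.grad (u j (n + 1))‖ ^ 2)
        ≤ (∑ n ∈ Finset.Icc 2 (N - 1), Δt / ν * EnBlended.negNorm (f j (n + 1)) ^ 2)
          + 1 / 12 * ‖EnBlended.vel (u j 2)‖ ^ 2
          + 1 / 12 * ‖EnBlended.vel ((3 : ℝ) • u j 2 - u j 1)‖ ^ 2
          + 1 / 12 * ‖EnBlended.vel
              ((3 : ℝ) • u j 2 - (3 : ℝ) • u j 1 + u j 0)‖ ^ 2 := by
  have h₂ := EnBlended.exists_isSobolevConst hd hΩb two_pos (by norm_num)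
  obtain ⟨K₂, h₂⟩ := h₂
  have h₃ := EnBlended.exists_isSobolevConst hd hΩb three_pos (by norm_num)
  obtain ⟨K₃, h₃⟩ := h₃
  have h₆ := EnBlended.exists_isSobolevConst hd hΩb (q := 6) (by norm_num) le_rfl
  obtain ⟨K₆, h₆⟩ := h₆
  refine ⟨24 * EnBlended.bStarConst d K₆ ^ 2 * Cinv + 1, by positivity, ?_⟩
  intro h hh Xh Qh hinv ν Δt hν hΔt J NT f u p hsol hfluct j N hN hNT
  have fluct_le (n : ℕ) (hn : 2 ≤ n) (hnN : n < N) : 24 * EnBlended.bStarConst d K₆ ^ 2 * Cinv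
      * (Δt / (ν * h)) * ‖EnBlended.grad (EnBlended.fluct u j n)‖ ^ 2 ≤ 1 := by
    refine le_trans ?_ (hfluct j n hn (hnN.trans_le hNT))
    gcongr
    exact le_add_of_nonneg_right zero_le_one
  have bound := hsol.energy_add_sum_le h₂ h₃ h₆ hν hΔt hh hinv hN.le hNT fluct_le
  have Icc_eq_Ico : Finset.Icc 2 (N - 1) = Finset.Ico 2 N := by grind
  simpa only [Icc_eq_Ico, add_assoc, EnBlended.energy, EnBlended.thirdDiff] using bound

theorem theorem1 {d : ℕ} (hd : d = 2 ∨ d = 3) (Ω : Set (EnBlended.Vec d)) (hΩ : IsOpen Ω)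
    (hΩb : Bornology.IsBounded Ω) (Cinv : ℝ) (hCinv : 0 < Cinv) :
    ∃ C : ℝ, 0 < C ∧
      ∀ (h : ℝ) (_ : 0 < h)
        (Xh : Submodule ℝ (EnBlended.H10 Ω)) (_ : FiniteDimensional ℝ Xh)
        (Qh : Submodule ℝ (EnBlended.L2 Ω ℝ)) (_ : FiniteDimensional ℝ Qh)
        (_ : (Qh : Set (EnBlended.L2 Ω ℝ)) ⊆ EnBlended.L20 Ω)
        (_ : ∀ v ∈ Xh, h * ‖EnBlended.grad v‖ ≤ Cinv * ‖EnBlended.vel v‖)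
        (ν Δt : ℝ) (_ : 0 < ν) (_ : 0 < Δt) (J NT : ℕ)
        (f : Fin J → ℕ → (EnBlended.H10 Ω →L[ℝ] ℝ))
        (u : Fin J → ℕ → EnBlended.H10 Ω) (p : Fin J → ℕ → EnBlended.L2 Ω ℝ)
        (_ : EnBlended.IsSchemeSolution Xh Qh ν Δt f NT u p)
        (_ : ∀ j n, 2 ≤ n → n < NT →
          C * (Δt / (ν * h)) * ‖EnBlended.grad (EnBlended.fluct u j n)‖ ^ 2 ≤ 1)
        (j : Fin J) (N : ℕ) (_ : 2 < N) (_ : N ≤ NT),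
        1 / 12 * ‖EnBlended.vel (u j N)‖ ^ 2
          + 1 / 12 * ‖EnBlended.vel ((3 : ℝ) • u j N - u j (N - 1))‖ ^ 2
          + 1 / 12 * ‖EnBlended.vel
              ((3 : ℝ) • u j N - (3 : ℝ) • u j (N - 1) + u j (N - 2))‖ ^ 2
          + 1 / 24 * (∑ n ∈ Finset.Icc 2 (N - 1), ‖EnBlended.vel
              (u j (n + 1) - (3 : ℝ) • u j n + (3 : ℝ) • u j (n - 1) - u j (n - 2))‖ ^ 2)
          + Δt / 4 * (∑ n ∈ Finset.Icc 2 (N - 1), ν * ‖EnBlended.grad (u j (n + 1))‖ ^ 2)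
        ≤ (∑ n ∈ Finset.Icc 2 (N - 1), Δt / ν * EnBlended.negNorm (f j (n + 1)) ^ 2)
          + 1 / 12 * ‖EnBlended.vel (u j 2)‖ ^ 2
          + 1 / 12 * ‖EnBlended.vel ((3 : ℝ) • u j 2 - u j 1)‖ ^ 2
          + 1 / 12 * ‖EnBlended.vel
              ((3 : ℝ) • u j 2 - (3 : ℝ) • u j 1 + u j 0)‖ ^ 2 :=
  (theorem1_general hd Ω hΩb Cinv hCinv).imp fun _ => And.imp_right
    fun stability h hh Xh _ Qh _ _ => stability h hh Xh Qh
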